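/- Let $R$ be an associative ring with unit, not necessarily commutative. A left or right $R$-module $M$ is FP-injective if $\mathrm{Ext}^1_R(F,M)=0$ for every finitely presented $R$-module $F$ on the same side. $R$ is a left (right) IF-ring if every finitely presented left (right) $R$-module embeds in a free $R$-module. $R$ is left coherent if every finitely generated left ideal of $R$ is finitely presented. $R$ is weakly quasi-Frobenius (WQF) if the bimodule ${}_RR_R$ determines a duality between the categories of finitely presented left and finitely presented right $R$-modules: the functors $M\mapsto M^*=\mathrm{Hom}_R(M,R)$ send finitely presented left $R$-modules to finitely presented right $R$-modules and conversely, and the evaluation map $M\to M^{**}$ is an isomorphism for every finitely presented left and every finitely presented right $R$-module $M$. The following assertions are equivalent: 1. $R$ is a WQF-ring; 2. $R$ is a left IF-ring and a right IF-ring; 3. $R$ is left coherent, the left module ${}_RR$ is FP-injective, and every cyclic finitely presented left $R$-module embeds in a free left $R$-module; 4. every FP-injective left $R$-module is flat and every FP-injective right $R$-module is flat; 5. every injective left $R$-module is flat and every injective right $R$-module is flat. -/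

import Mathlib

/-! Conventions. A ring is associative with unit, not necessarily commutative. A left `R`-module is
a `Module R M`; a right `R`-module is a `Module Rᵐᵒᵖ N`, with `x · r = MulOpposite.op r • x`.
A notion for left modules is used for right `R`-modules as the same notion over `Rᵐᵒᵖ`. -/

universe u

open scoped TensorProduct

section Flatness

variable (R : Type u) [Ring R]

/-- The subgroup of `K ⊗[ℤ] M` generated by the elements `(k · r) ⊗ m - k ⊗ (r • m)`, where `K` is a
right `R`-module and `M` a left `R`-module. -/
def balancedRelations (K M : Type u) [AddCommGroup K] [Module Rᵐᵒᵖ K] [AddCommGroup M]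
    [Module R M] : AddSubgroup (K ⊗[ℤ] M) :=
  AddSubgroup.closure {t | ∃ (k : K) (r : R) (m : M),
    t = (MulOpposite.op r • k) ⊗ₜ[ℤ] m - k ⊗ₜ[ℤ] (r • m)}

/-- The tensor product `K ⊗_R M` of a right module and a left module over a noncommutative ring. -/
abbrev BalancedTensor (K M : Type u) [AddCommGroup K] [Module Rᵐᵒᵖ K] [AddCommGroup M]
    [Module R M] : Type u :=
  (K ⊗[ℤ] M) ⧸ balancedRelations R K M

/-- The additive map `f ⊗ M : K ⊗[ℤ] M → L ⊗[ℤ] M`. -/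
def intTensorMap {K L : Type u} (M : Type u) [AddCommGroup K] [AddCommGroup L]
    [AddCommGroup M] (f : K →+ L) : K ⊗[ℤ] M →+ L ⊗[ℤ] M :=
  (f.toIntLinearMap.rTensor M).toAddMonoidHom

theorem intTensorMap_tmul {K L : Type u} (M : Type u) [AddCommGroup K] [AddCommGroup L]
    [AddCommGroup M] (f : K →+ L) (k : K) (m : M) :
    intTensorMap M f (k ⊗ₜ[ℤ] m) = f k ⊗ₜ[ℤ] m := rfl

theorem balancedRelations_le_comap {K L : Type u} (M : Type u) [AddCommGroup K] [Module Rᵐᵒᵖ K]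
    [AddCommGroup L] [Module Rᵐᵒᵖ L] [AddCommGroup M] [Module R M] (f : K →ₗ[Rᵐᵒᵖ] L) :
    balancedRelations R K M ≤
      (balancedRelations R L M).comap (intTensorMap M f.toAddMonoidHom) := by
  refine (AddSubgroup.closure_le _).2 ?_
  rintro _ ⟨k, r, m, rfl⟩
  refine AddSubgroup.subset_closure ⟨f k, r, m, ?_⟩
  simp [map_sub, intTensorMap_tmul]

/-- The induced map `f ⊗ M : K ⊗_R M → L ⊗_R M`. -/
def balancedTensorMap {K L : Type u} (M : Type u) [AddCommGroup K] [Module Rᵐᵒᵖ K]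
    [AddCommGroup L] [Module Rᵐᵒᵖ L] [AddCommGroup M] [Module R M] (f : K →ₗ[Rᵐᵒᵖ] L) :
    BalancedTensor R K M →+ BalancedTensor R L M :=
  QuotientAddGroup.map _ _ (intTensorMap M f.toAddMonoidHom)
    (balancedRelations_le_comap R M f)

/-- A left `R`-module `M` is flat if `- ⊗_R M` preserves monomorphisms of right `R`-modules.
(Mathlib's `Module.Flat` is only available over commutative rings.) -/
def IsFlatModule (M : Type u) [AddCommGroup M] [Module R M] : Prop :=
  ∀ (K L : Type u) [AddCommGroup K] [Module Rᵐᵒᵖ K] [AddCommGroup L] [Module Rᵐᵒᵖ L]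
    (f : K →ₗ[Rᵐᵒᵖ] L), Function.Injective f → Function.Injective (balancedTensorMap R M f)

end Flatness

section Rings

variable (R : Type u) [Ring R]

/-- A left `R`-module `M` is FP-injective (absolutely pure) if `Ext¹_R(F, M) = 0` for every
finitely presented left `R`-module `F`. -/
def IsFPInjective (M : Type u) [AddCommGroup M] [Module R M] : Prop :=
  ∀ F : ModuleCat.{u} R, Module.FinitePresentation R F →
    Subsingleton (CategoryTheory.Abelian.Ext.{u} F (ModuleCat.of R M) 1)

/-- `R` is left coherent: every finitely generated left ideal is finitely presented. -/
def IsLeftCoherent : Prop :=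
  ∀ I : Ideal R, I.FG → Module.FinitePresentation R I

/-- The left `R`-module `M` embeds in a free left `R`-module. -/
def EmbedsInFree (M : Type u) [AddCommGroup M] [Module R M] : Prop :=
  ∃ (F : Type u) (_ : AddCommGroup F) (_ : Module R F) (_ : Module.Free R F) (f : M →ₗ[R] F),
    Function.Injective f

/-- `R` is a left IF-ring: every finitely presented left `R`-module embeds in a free module. -/
def IsLeftIFRing : Prop :=
  ∀ (M : Type u) [AddCommGroup M] [Module R M],
    Module.FinitePresentation R M → EmbedsInFree R M

/-- The evaluation map `M → M**` of a left `R`-module, where `M* = Hom_R(M, R)` is a right `R`-module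
through the right multiplication of `R`, and `M**` the dual of this right module. -/
def evalLeft (M : Type u) [AddCommGroup M] [Module R M] :
    M →ₗ[R] ((M →ₗ[R] R) →ₗ[Rᵐᵒᵖ] R) where
  toFun m :=
    { toFun := fun φ => φ m
      map_add' := fun _ _ => rfl
      map_smul' := fun _ _ => rfl }
  map_add' m m' := by ext φ; exact map_add φ m m'
  map_smul' r m := by ext φ; exact map_smul φ r m

/-- The evaluation map `N → N**` of a right `R`-module, where `N* = Hom_R(N, R)` is a left `R`-module
through the left multiplication of `R`. -/
def evalRight (N : Type u) [AddCommGroup N] [Module Rᵐᵒᵖ N] :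
    N →ₗ[Rᵐᵒᵖ] ((N →ₗ[Rᵐᵒᵖ] R) →ₗ[R] R) where
  toFun n :=
    { toFun := fun φ => φ n
      map_add' := fun _ _ => rfl
      map_smul' := fun _ _ => rfl }
  map_add' n n' := by ext φ; exact map_add φ n n'
  map_smul' r n := by ext φ; exact map_smul φ r n

/-- `R` is weakly quasi-Frobenius: the bimodule `R` determines a duality between the categories of
finitely presented left and finitely presented right `R`-modules, that is, the contravariant
functors `Hom_R(-, R)` restrict to functors between these two categories which are mutually inverse
through the natural evaluation maps into the double dual. -/
structure IsWQFRing : Prop where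
  dual_left : ∀ (M : Type u) [AddCommGroup M] [Module R M],
    Module.FinitePresentation R M → Module.FinitePresentation Rᵐᵒᵖ (M →ₗ[R] R)
  dual_right : ∀ (N : Type u) [AddCommGroup N] [Module Rᵐᵒᵖ N],
    Module.FinitePresentation Rᵐᵒᵖ N → Module.FinitePresentation R (N →ₗ[Rᵐᵒᵖ] R)
  eval_left : ∀ (M : Type u) [AddCommGroup M] [Module R M],
    Module.FinitePresentation R M → Function.Bijective (evalLeft R M)
  eval_right : ∀ (N : Type u) [AddCommGroup N] [Module Rᵐᵒᵖ N],
    Module.FinitePresentation Rᵐᵒᵖ N → Function.Bijective (evalRight R N)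

end Rings

/-! ### FP-injectivity as an extension property. -/

section FPInjective

open CategoryTheory Abelian

variable {R : Type u} [Ring R]

/-! Every assertion is compared with the two-sided IF condition.

Flatness enters through factorization: a module is flat iff every map into it from a finitely
presented module factors through a free one (`IsFlatModule.exists_factorization`,
`isFlatModule_of_factorization`). Over a left IF-ring a finitely presented `N` lies in some `R^k`
with finitely presented cokernel, so maps from `N` to an FP-injective module extend to `R^k`, and
that module is flat. Conversely, embed a finitely presented module in an injective one; if the
latter is flat, the embedding factors through a free module, and its first factor is injective.

The other conditions are linear algebra with annihilators between `R^n` and `S^n`, where `S = Rᵐᵒᵖ`.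
Left IF means that finitely generated submodules of `R^n` are annihilators of finitely generated
submodules of `S^n`. FP-injectivity of the left module `R` is the double annihilator condition for
finitely generated submodules of `S^n`; left coherence says that their annihilators are finitely
generated. The last two together yield right IF, while left IF follows from the cyclic case by
induction on generators. Finally, the dual of `R^n/P` is the annihilator of `P`, which turns these
facts into the duality. A pair of rings acting on `U` makes each argument usable on both sides. -/

theorem IsFPInjective.exists_extension {M : Type u} [AddCommGroup M] [Module R M]
    (hM : IsFPInjective R M) {K L : Type u} [AddCommGroup K] [Module R K] [AddCommGroup L]
    [Module R L] (f : K →ₗ[R] L) (hf : Function.Injective f)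
    (hfp : Module.FinitePresentation R (L ⧸ LinearMap.range f)) (g : K →ₗ[R] M) :
    ∃ h : L →ₗ[R] M, ∀ x, h (f x) = g x := by
  have hS := ModuleCat.shortComplex_shortExact
    (ModuleCat.shortComplexOfCompEqZero _ _ f.exact_map_mkQ_range.linearMap_comp_eq_zero)
    f.exact_map_mkQ_range hf (Submodule.mkQ_surjective _)
  have := hM (ModuleCat.of R (L ⧸ LinearMap.range f)) hfp
  -- The obstruction to extending `g` lies in `Ext¹` of the cokernel, which vanishes.
  obtain ⟨y, hy⟩ := Ext.contravariant_sequence_exact₁ hS (ModuleCat.of R M)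
    (Ext.mk₀ (ModuleCat.ofHom g)) rfl (Subsingleton.elim (α := Ext (ModuleCat.of R
      (L ⧸ LinearMap.range f)) (ModuleCat.of R M) 1) _ _)
  obtain ⟨y, rfl⟩ := Ext.addEquiv₀.symm.surjective y
  have h2 : ModuleCat.ofHom f ≫ y = ModuleCat.ofHom g := by
    apply Ext.addEquiv₀.symm.injective
    simpa using! hy
  exact ⟨y.hom, fun x => congr($(h2).hom x)⟩

/-- It is enough to extend maps from finitely generated submodules of finite free modules. -/
theorem IsFPInjective.of_extension {M : Type u} [AddCommGroup M] [Module R M]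
    (h : ∀ (n : ℕ) (P : Submodule R (Fin n → R)), P.FG → ∀ g : P →ₗ[R] M,
      ∃ e : (Fin n → R) →ₗ[R] M, ∀ x : P, e x = g x) : IsFPInjective R M := by
  intro F hF
  obtain ⟨n, f, hf⟩ := Module.Finite.exists_fin' R F
  have hS := LinearMap.shortExact_shortComplexKer hf
  have : Projective (ModuleCat.of R (Fin n → R)) :=
    (IsProjective.iff_projective (Fin n → R)).1 inferInstance
  refine subsingleton_of_forall_eq 0 fun x => ?_
  -- As `R^n` is projective, every class comes from a map on the kernel; it vanishes once that map
  -- extends to `R^n`.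
  obtain ⟨y, rfl⟩ := Ext.contravariant_sequence_exact₃ hS (ModuleCat.of R M) x
    (Ext.eq_zero_of_projective (P := ModuleCat.of R (Fin n → R)) _) (n₀ := 0) rfl
  obtain ⟨y, rfl⟩ := Ext.addEquiv₀.symm.surjective y
  obtain ⟨e, he⟩ := h n (LinearMap.ker f) (Module.FinitePresentation.fg_ker f hf) y.hom
  have : y = f.shortComplexKer.f ≫ ModuleCat.ofHom e := by
    ext x; exact (he x).symm
  rw [this, Ext.addEquiv₀_symm_apply, ← Ext.mk₀_comp_mk₀]
  exact hS.extClass_comp_assoc _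

theorem Module.Injective.isFPInjective {M : Type u} [AddCommGroup M] [Module R M]
    (hM : Module.Injective R M) : IsFPInjective R M := by
  intro F _
  have := Module.injective_object_of_injective_module R M
  exact subsingleton_of_forall_eq 0 Ext.eq_zero_of_injective

theorem exists_injective_to_injective (M : Type u) [AddCommGroup M] [Module R M] :
    ∃ (E : Type u) (_ : AddCommGroup E) (_ : Module R E) (f : M →ₗ[R] E),
      Module.Injective R E ∧ Function.Injective f := by
  have := ModuleCat.enoughInjectives.{u} R
  obtain ⟨I, _, f, _⟩ := EnoughInjectives.presentation (ModuleCat.of R M)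
  exact ⟨I, inferInstance, inferInstance, f.hom, Module.injective_module_of_injective_object R I,
    (ModuleCat.mono_iff_injective f).1 ‹_›⟩

end FPInjective

/-! ### Embeddings in finite free modules. -/

section Embedding

variable {R : Type u} [Ring R]

theorem EmbedsInFree.exists_fin {M : Type u} [AddCommGroup M] [Module R M] [Module.Finite R M]
    (h : EmbedsInFree R M) :
    ∃ (k : ℕ) (f : M →ₗ[R] (Fin k → R)), Function.Injective f := by
  classical
  obtain ⟨F, _, _, _, f, hf⟩ := h
  let b := Module.Free.chooseBasis R F
  obtain ⟨s, hs⟩ := Module.Finite.fg_top (R := R) (M := M)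
  -- The basis coordinates met by the generators are the only ones met by any element.
  let t : Finset (Module.Free.ChooseBasisIndex R F) := s.biUnion fun m => (b.repr (f m)).support
  have ht : ∀ m : M, (b.repr (f m)).support ⊆ t := by
    intro m
    have hm : m ∈ Submodule.span R (s : Set M) := hs ▸ Submodule.mem_top
    induction hm using Submodule.span_induction with
    | mem x hx => exact Finset.subset_biUnion_of_mem (fun m => (b.repr (f m)).support) hx
    | zero => simp
    | add x y _ _ hx hy =>
      rw [map_add, map_add]
      exact Finsupp.support_add.trans (Finset.union_subset hx hy)
    | smul r x _ hx =>
      rw [map_smul, map_smul]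
      exact Finsupp.support_smul.trans hx
  refine ⟨t.card, LinearMap.pi fun i => Finsupp.lapply (t.equivFin.symm i).1 ∘ₗ
    b.repr.toLinearMap ∘ₗ f, (injective_iff_map_eq_zero _).2 fun m hm => ?_⟩
  have : b.repr (f m) = 0 := by
    ext i
    by_cases hi : i ∈ t
    · simpa using congr_fun hm (t.equivFin ⟨i, hi⟩)
    · by_contra h0
      exact hi (ht m (by simpa using h0))
  exact hf (by simpa using this)

end Embedding

/-! ### Balanced tensor products; flatness of finite free modules. -/

section BalancedTensor

variable {R : Type u} [Ring R] {K L M F A : Type u} [AddCommGroup K] [Module Rᵐᵒᵖ K]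
  [AddCommGroup L] [Module Rᵐᵒᵖ L] [AddCommGroup M] [Module R M] [AddCommGroup F] [Module R F]
  [AddCommGroup A]

/-- The class of a pure tensor in the balanced tensor product, as a biadditive map. -/
def balancedTmul (R : Type u) [Ring R] (K M : Type u) [AddCommGroup K] [Module Rᵐᵒᵖ K]
    [AddCommGroup M] [Module R M] : K →+ M →+ BalancedTensor R K M :=
  AddMonoidHom.mk' (fun k => AddMonoidHom.mk' (fun m => QuotientAddGroup.mk (k ⊗ₜ[ℤ] m))
    fun m m' => by rw [TensorProduct.tmul_add]; rfl)
    fun k k' => by ext m; simp [TensorProduct.add_tmul]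

theorem balancedTmul_smul (k : K) (r : R) (m : M) :
    balancedTmul R K M k (r • m) = balancedTmul R K M (MulOpposite.op r • k) m := by
  refine QuotientAddGroup.eq.2 ?_
  rw [neg_add_eq_sub]
  exact AddSubgroup.subset_closure ⟨k, r, m, rfl⟩

theorem balancedTensorMap_tmul (f : K →ₗ[Rᵐᵒᵖ] L) (k : K) (m : M) :
    balancedTensorMap R M f (balancedTmul R K M k m) = balancedTmul R L M (f k) m := rfl

theorem BalancedTensor.induction {p : BalancedTensor R K M → Prop} (t : BalancedTensor R K M)
    (tmul : ∀ k m, p (balancedTmul R K M k m)) (add : ∀ x y, p x → p y → p (x + y)) : p t := by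
  obtain ⟨t, rfl⟩ := QuotientAddGroup.mk_surjective t
  induction t with
  | zero => simpa using! tmul 0 0
  | tmul k m => exact tmul k m
  | add x y hx hy => exact add _ _ hx hy

theorem BalancedTensor.addHom_ext {f g : BalancedTensor R K M →+ A}
    (h : ∀ k m, f (balancedTmul R K M k m) = g (balancedTmul R K M k m)) : f = g := by
  refine AddMonoidHom.ext fun t => ?_
  induction t using BalancedTensor.induction with
  | tmul k m => exact h k m
  | add x y hx hy => rw [map_add, map_add, hx, hy]

/-- The universal property of the balanced tensor product. -/
def balancedLift (g : K →+ M →+ A)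
    (hg : ∀ k (r : R) m, g (MulOpposite.op r • k) m = g k (r • m)) : BalancedTensor R K M →+ A :=
  QuotientAddGroup.lift _ (TensorProduct.liftAddHom g fun r k m => by simp) <| by
    refine (AddSubgroup.closure_le _).2 ?_
    rintro _ ⟨k, r, m, rfl⟩
    simp [hg]

/-- The induced map `K ⊗ b : K ⊗_R M → K ⊗_R F`. -/
def balancedTensorMapRight (K : Type u) [AddCommGroup K] [Module Rᵐᵒᵖ K] (b : M →ₗ[R] F) :
    BalancedTensor R K M →+ BalancedTensor R K F :=
  balancedLift ((balancedTmul R K F).compl₂ b.toAddMonoidHom) fun k r m => by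
    simp [balancedTmul_smul]

theorem balancedTensorMapRight_tmul (b : M →ₗ[R] F) (k : K) (m : M) :
    balancedTensorMapRight K b (balancedTmul R K M k m) = balancedTmul R K F k (b m) := rfl

/-- `K ⊗_R R^n → K^n`. -/
def balancedToPi (K : Type u) [AddCommGroup K] [Module Rᵐᵒᵖ K] (n : ℕ) :
    BalancedTensor R K (Fin n → R) →+ (Fin n → K) :=
  balancedLift (AddMonoidHom.mk' (fun k => AddMonoidHom.mk' (fun x i => MulOpposite.op (x i) • k)
    fun x y => by ext i; simp [add_smul]) fun k k' => by ext x i; simp) fun k r x => by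
      ext i; simp [mul_smul]

theorem balancedToPi_tmul (n : ℕ) (k : K) (x : Fin n → R) (i : Fin n) :
    balancedToPi K n (balancedTmul R K _ k x) i = MulOpposite.op (x i) • k := rfl

theorem balancedToPi_injective (n : ℕ) : Function.Injective (balancedToPi (R := R) K n) := by
  let g : (Fin n → K) →+ BalancedTensor R K (Fin n → R) :=
    ∑ i, ((balancedTmul R K (Fin n → R)).flip (Pi.single i 1)).comp (Pi.evalAddMonoidHom _ i)
  have : g.comp (balancedToPi K n) = AddMonoidHom.id _ := by
    refine BalancedTensor.addHom_ext fun k x => ?_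
    simp only [g, AddMonoidHom.comp_apply, AddMonoidHom.finsetSum_apply, AddMonoidHom.flip_apply,
      Pi.evalAddMonoidHom_apply, AddMonoidHom.id_apply, balancedToPi_tmul, ← balancedTmul_smul]
    rw [← map_sum, ← pi_eq_sum_univ' x]
  exact Function.LeftInverse.injective (g := g) fun t => congr($this t)

theorem isFlatModule_pi (n : ℕ) : IsFlatModule R (Fin n → R) := by
  intro K L _ _ _ _ f hf
  have : (f.toAddMonoidHom.compLeft (Fin n)).comp (balancedToPi (R := R) K n) =
      (balancedToPi (R := R) L n).comp (balancedTensorMap R (Fin n → R) f) := by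
    refine BalancedTensor.addHom_ext fun k x => ?_
    ext i
    exact f.map_smul (MulOpposite.op (x i)) k
  have h2 : Function.Injective
      ((f.toAddMonoidHom.compLeft (Fin n)).comp (balancedToPi (R := R) K n)) :=
    (hf.comp_left).comp (balancedToPi_injective n)
  rw [this] at h2
  exact Function.Injective.of_comp h2

end BalancedTensor

/-! ### Flatness and factorization through free modules. -/

section Flat

variable {R : Type u} [Ring R]

/-- The equational criterion: the images `x` of the generators satisfy the relations of `N`, and
flatness writes `x` as a finite sum of vectors `s • y` with `s` a solution of these relations in
`R^n`. Each `s` is a map `N → R`, so each summand factors through `R`, and their sum through a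
product. -/
theorem IsFlatModule.exists_factorization {M N : Type u} [AddCommGroup M] [Module R M]
    [AddCommGroup N] [Module R N] (hM : IsFlatModule R M) (hN : Module.FinitePresentation R N)
    (g : N →ₗ[R] M) :
    ∃ (F : Type u) (_ : AddCommGroup F) (_ : Module R F) (_ : Module.Free R F)
      (a : N →ₗ[R] F) (b : F →ₗ[R] M), b ∘ₗ a = g := by
  obtain ⟨n, p, hp⟩ := Module.Finite.exists_fin' R N
  obtain ⟨t, ht⟩ := Module.FinitePresentation.fg_ker p hp
  let φ : (Fin n → R) →ₗ[Rᵐᵒᵖ] (t → R) :=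
    { toFun := fun s q => ∑ i, q.1 i * s i
      map_add' := fun s s' => by ext; simp [mul_add, Finset.sum_add_distrib]
      map_smul' := fun r s => by ext; simp [Finset.sum_mul, mul_assoc] }
  let K := LinearMap.ker φ
  let ι : ((Fin n → R) ⧸ K) →ₗ[Rᵐᵒᵖ] (t → R) := K.liftQ φ le_rfl
  have hι : Function.Injective ι := LinearMap.ker_eq_bot.1 (Submodule.ker_liftQ_eq_bot _ _ _ le_rfl)
  let e : Fin n → Fin n → R := fun i => Pi.single i 1
  let x : Fin n → M := fun i => g (p (e i))
  have hx : ∀ r : Fin n → R, ∑ i, r i • x i = g (p r) := fun r => by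
    simp_rw [x, ← map_smul, ← map_sum]
    rw [← pi_eq_sum_univ' r]
  -- Under `ι`, this tensor becomes a sum over the relations `q` of tensors with `∑ q i • x i = 0`;
  -- flatness then gives `w = 0`.
  let w := ∑ i, balancedTmul R ((Fin n → R) ⧸ K) M (K.mkQ (e i)) (x i)
  have hw : w = 0 := by
    classical
    apply hM _ _ ι hι
    rw [map_zero]
    simp only [w, map_sum, balancedTensorMap_tmul]
    have h1 : ∀ i, ι (K.mkQ (e i)) =
        ∑ q : t, MulOpposite.op (q.1 i) • (Pi.single q 1 : t → R) := fun i => by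
      ext q
      simp [ι, φ, e, Finset.sum_apply, Pi.single_apply]
    simp_rw [h1, map_sum, AddMonoidHom.finsetSum_apply, ← balancedTmul_smul]
    rw [Finset.sum_comm]
    refine Finset.sum_eq_zero fun q _ => ?_
    rw [← map_sum, hx, show p q.1 = 0 from ht.le (Submodule.subset_span q.2), map_zero, map_zero]
  let D : AddSubgroup (Fin n → M) :=
    AddSubgroup.closure {z | ∃ s ∈ K, ∃ y : M, z = fun i => s i • y}
  -- Since `ψ` sends `w` to the class of `x`, the vanishing of `w` puts `x` in `D`.
  let ψ : BalancedTensor R ((Fin n → R) ⧸ K) M →+ (Fin n → M) ⧸ D :=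
    balancedLift (QuotientAddGroup.lift K.toAddSubgroup
      (AddMonoidHom.mk' (fun s => AddMonoidHom.mk'
        (fun y => QuotientAddGroup.mk (s := D) fun i => s i • y)
        fun y y' => by
          rw [← QuotientAddGroup.mk_add]; congr 1; ext i; simp)
        fun s s' => by
          ext y
          simp only [AddMonoidHom.mk'_apply, AddMonoidHom.add_apply]
          rw [← QuotientAddGroup.mk_add]; congr 1; ext i; simp [add_smul])
      fun s hs => by
        ext y
        exact (QuotientAddGroup.eq_zero_iff _).2 (AddSubgroup.subset_closure ⟨s, hs, y, rfl⟩))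
      fun k r m => by
        obtain ⟨s, rfl⟩ := K.mkQ_surjective k
        exact congrArg (QuotientAddGroup.mk (s := D)) (funext fun i => mul_smul (s i) r m)
  have hxD : x ∈ D := by
    rw [← QuotientAddGroup.eq_zero_iff]
    have h1 : ψ w = QuotientAddGroup.mk (s := D) x := by
      have h2 : ∀ i, ψ (balancedTmul R ((Fin n → R) ⧸ K) M (K.mkQ (e i)) (x i)) =
          QuotientAddGroup.mk' D (fun j => e i j • x i) := fun i => rfl
      simp only [w, map_sum, h2]
      rw [← map_sum]
      refine congrArg (QuotientAddGroup.mk (s := D)) ?_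
      ext j
      simp [e, Finset.sum_apply, Pi.single_apply]
    rw [← h1, hw, map_zero]
  have key : ∃ (F : Type u) (_ : AddCommGroup F) (_ : Module R F) (_ : Module.Free R F)
      (a : N →ₗ[R] F) (b : F →ₗ[R] M), ∀ i, b (a (p (e i))) = x i := by
    -- Forgetting the origin of `x` allows induction over all of `D`.
    clear_value x
    clear hx hw w
    induction hxD using AddSubgroup.closure_induction with
    | mem z hz =>
      obtain ⟨s, hs, y, rfl⟩ := hz
      let f : (Fin n → R) →ₗ[R] R := Fintype.linearCombination R s
      have hf : LinearMap.ker p ≤ LinearMap.ker f := by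
        rw [← ht, Submodule.span_le]
        intro q hq
        exact congr_fun (show φ s = 0 from hs) ⟨q, hq⟩
      refine ⟨R, _, _, inferInstance, (LinearMap.ker p).liftQ f hf ∘ₗ
        (p.quotKerEquivOfSurjective hp).symm.toLinearMap, LinearMap.toSpanSingleton R M y,
        fun i => ?_⟩
      have : (p.quotKerEquivOfSurjective hp).symm (p (e i)) = Submodule.Quotient.mk (e i) := by
        rw [LinearEquiv.symm_apply_eq]; rfl
      simp [this, f, e, Fintype.linearCombination_apply_single]
    | zero => exact ⟨R, _, _, inferInstance, 0, 0, fun i => by simp⟩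
    | add z z' _ _ hz hz' =>
      obtain ⟨F, _, _, _, a, b, h⟩ := hz
      obtain ⟨F', _, _, _, a', b', h'⟩ := hz'
      exact ⟨F × F', _, _, inferInstance, a.prod a', b.coprod b', fun i => by simp [h, h']⟩
    | neg z _ hz =>
      obtain ⟨F, _, _, _, a, b, h⟩ := hz
      exact ⟨F, _, _, inferInstance, a, -b, fun i => by simp [h]⟩
  obtain ⟨F, _, _, _, a, b, h⟩ := key
  refine ⟨F, _, _, inferInstance, a, b, ?_⟩
  rw [← LinearMap.cancel_right hp]
  ext i
  exact h i

/-- The vanishing of a tensor in `L ⊗ M` uses only finitely many elements and relations of `M`.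
These define a finitely presented module over `M`; factoring it through `R^k` lifts the tensor to `K
⊗ R^k`, where it already vanishes because `R^k` is flat. -/
theorem isFlatModule_of_factorization {M : Type u} [AddCommGroup M] [Module R M]
    (h : ∀ (N : Type u) [AddCommGroup N] [Module R N], Module.FinitePresentation R N →
      ∀ g : N →ₗ[R] M, ∃ (k : ℕ) (a : N →ₗ[R] (Fin k → R)) (b : (Fin k → R) →ₗ[R] M),
        b ∘ₗ a = g) : IsFlatModule R M := by
  classical
  intro K L _ _ _ _ f hf
  rw [injective_iff_map_eq_zero]
  intro t ht
  obtain ⟨v, rfl⟩ : ∃ v : M →₀ K, v.sum (fun m k => balancedTmul R K M k m) = t := by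
    clear ht
    induction t using BalancedTensor.induction with
    | tmul k m => exact ⟨Finsupp.single m k, by simp⟩
    | add x y hx hy =>
      obtain ⟨v, rfl⟩ := hx
      obtain ⟨w, rfl⟩ := hy
      exact ⟨v + w, Finsupp.sum_add_index' (by simp) (by simp)⟩
  -- A linear relation `κ` among elements of `M`, multiplied by `l`, is a formal sum that vanishes
  -- in `L ⊗ M`. Such sums generate `Z T₀`.
  let act (κ : M →₀ R) (l : L) : M →₀ L := κ.mapRange (fun r => MulOpposite.op r • l) (by simp)
  let Z : Set ((M →₀ R) × L) → AddSubgroup (M →₀ L) := fun T =>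
    AddSubgroup.closure {z | ∃ q ∈ T, z = act q.1 q.2}
  let T₀ : Set ((M →₀ R) × L) := {q | Finsupp.linearCombination R id q.1 = 0}
  have mem0 : ∀ (κ : M →₀ R) (l : L), Finsupp.linearCombination R id κ = 0 → act κ l ∈ Z T₀ :=
    fun κ l hκ => AddSubgroup.subset_closure ⟨(κ, l), hκ, rfl⟩
  let ψ : BalancedTensor R L M →+ (M →₀ L) ⧸ Z T₀ :=
    balancedLift (AddMonoidHom.mk' (fun l => AddMonoidHom.mk'
        (fun m => QuotientAddGroup.mk (s := Z T₀) (Finsupp.single m l))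
        fun m m' => by
          rw [← QuotientAddGroup.mk_add, eq_comm, QuotientAddGroup.eq_iff_sub_mem]
          have := mem0 (Finsupp.single m 1 + Finsupp.single m' 1 - Finsupp.single (m + m') 1) l
            (by simp)
          convert! this using 1
          ext i
          simp [act, sub_smul, add_smul, Finsupp.single_apply, apply_ite MulOpposite.op, ite_smul])
        fun l l' => by
          ext m
          simp only [AddMonoidHom.mk'_apply, AddMonoidHom.add_apply]
          rw [← QuotientAddGroup.mk_add, Finsupp.single_add])
      fun l r m => by
        simp only [AddMonoidHom.mk'_apply]
        rw [QuotientAddGroup.eq_iff_sub_mem]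
        have := mem0 (Finsupp.single m r - Finsupp.single (r • m) 1) l (by simp)
        convert! this using 1
        ext i
        simp [act, sub_smul, Finsupp.single_apply, apply_ite MulOpposite.op, ite_smul]
  have hv : v.mapRange f f.map_zero ∈ Z T₀ := by
    rw [← QuotientAddGroup.eq_zero_iff, ← map_zero ψ, ← ht, Finsupp.sum, map_sum, map_sum]
    have h2 : ∀ m, ψ (balancedTensorMap R M f (balancedTmul R K M (v m) m)) =
        QuotientAddGroup.mk' (Z T₀) (Finsupp.single m (f (v m))) := fun m => rfl
    simp only [h2]
    rw [← map_sum]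
    refine congrArg (QuotientAddGroup.mk (s := Z T₀)) ?_
    ext m
    simp only [Finsupp.mapRange_apply, Finsupp.finsetSum_apply, Finsupp.single_apply]
    rw [Finset.sum_ite_eq']
    split_ifs with hm
    · rfl
    · rw [Finsupp.notMem_support_iff.1 hm, map_zero]
  obtain ⟨T, hT, hvT⟩ : ∃ T : Finset ((M →₀ R) × L), (T : Set _) ⊆ T₀ ∧
      v.mapRange f f.map_zero ∈ Z T := by
    generalize v.mapRange f f.map_zero = z at hv
    induction hv using AddSubgroup.closure_induction with
    | mem z hz =>
      obtain ⟨q, hq, rfl⟩ := hz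
      exact ⟨{q}, by simpa using hq, AddSubgroup.subset_closure ⟨q, by simp, rfl⟩⟩
    | zero => exact ⟨∅, by simp, zero_mem _⟩
    | add x y _ _ hx hy =>
      obtain ⟨T, hT, hx⟩ := hx
      obtain ⟨T', hT', hy⟩ := hy
      refine ⟨T ∪ T', by simp [hT, hT'], add_mem ?_ ?_⟩
      · refine AddSubgroup.closure_mono ?_ hx
        rintro z ⟨q, hq, hz⟩
        exact ⟨q, Finset.mem_coe.2 (Finset.mem_union_left _ hq), hz⟩
      · refine AddSubgroup.closure_mono ?_ hy
        rintro z ⟨q, hq, hz⟩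
        exact ⟨q, Finset.mem_coe.2 (Finset.mem_union_right _ hq), hz⟩
    | neg x _ hx =>
      obtain ⟨T, hT, hx⟩ := hx
      exact ⟨T, hT, neg_mem hx⟩
  let S : Finset M := v.support ∪ T.biUnion fun q => q.1.support
  let P : Submodule R (S → R) :=
    Submodule.span R ((fun q : (M →₀ R) × L => fun i : S => q.1 i) '' T)
  have sum_S : ∀ q ∈ T, ∀ {A : Type u} [AddCommGroup A] (c : M → R → A), (∀ m, c m 0 = 0) →
      ∑ i : S, c i (q.1 i) = q.1.sum c := fun q hq A _ c hc => by
    rw [Finset.sum_coe_sort S fun m => c m (q.1 m)]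
    refine (Finsupp.sum_of_support_subset q.1 ?_ c fun m _ => hc m).symm
    exact (Finset.subset_biUnion_of_mem (fun q : (M →₀ R) × L => q.1.support) hq).trans
      Finset.subset_union_right
  have hP : P ≤ LinearMap.ker (Fintype.linearCombination R (fun i : S => (i : M))) := by
    rw [Submodule.span_le]
    rintro _ ⟨q, hq, rfl⟩
    have := hT hq
    simp only [SetLike.mem_coe, LinearMap.mem_ker, Fintype.linearCombination_apply]
    rw [sum_S q hq (fun m r => r • m) (by simp)]
    exact this
  obtain ⟨k, a, b, hab⟩ := h ((S → R) ⧸ P) (Module.finitePresentation_of_surjective P.mkQ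
    P.mkQ_surjective (by rw [Submodule.ker_mkQ]; exact Submodule.fg_span (T.finite_toSet.image _)))
    (P.liftQ _ hP)
  -- Only values on `S` matter; `0` elsewhere is a filler.
  let α : M → (Fin k → R) := fun m => if hm : m ∈ S then a (P.mkQ (Pi.single ⟨m, hm⟩ 1)) else 0
  have hα : ∀ i : S, α i = a (P.mkQ (Pi.single i 1)) := fun i => by simp [α]
  have hbα : ∀ m ∈ S, b (α m) = m := fun m hm => by
    rw [hα ⟨m, hm⟩, ← LinearMap.comp_apply, hab]
    simp [Fintype.linearCombination_apply_single]
  have hTα : ∀ q ∈ T, q.1.sum (fun m r => r • α m) = 0 := fun q hq => by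
    rw [← sum_S q hq _ (by simp)]
    simp_rw [hα, ← map_smul, ← map_sum]
    rw [← pi_eq_sum_univ' (fun i : S => q.1 i)]
    have : P.mkQ (fun i : S => q.1 i) = 0 := by
      rw [← LinearMap.mem_ker, Submodule.ker_mkQ]
      exact Submodule.subset_span ⟨q, hq, rfl⟩
    rw [this, map_zero]
  let Φ : (M →₀ L) →+ BalancedTensor R L (Fin k → R) :=
    Finsupp.liftAddHom fun m => (balancedTmul R L (Fin k → R)).flip (α m)
  have hΦ : Z T ≤ Φ.ker := by
    refine (AddSubgroup.closure_le _).2 ?_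
    rintro _ ⟨q, hq, rfl⟩
    have h1 : Φ (act q.1 q.2) =
        q.1.sum fun m r => balancedTmul R L _ (MulOpposite.op r • q.2) (α m) := by
      simp only [Φ, act, Finsupp.liftAddHom_apply]
      rw [Finsupp.sum_mapRange_index (by simp)]
      rfl
    simp only [SetLike.mem_coe, AddMonoidHom.mem_ker]
    rw [h1]
    simp_rw [← balancedTmul_smul]
    rw [← map_finsuppSum, hTα q hq, map_zero]
  have hzero : v.sum (fun m k => balancedTmul R K _ k (α m)) = 0 := by
    apply isFlatModule_pi k K L f hf
    rw [map_zero, map_finsuppSum]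
    have := hΦ hvT
    rw [AddMonoidHom.mem_ker, Finsupp.liftAddHom_apply, Finsupp.sum_mapRange_index (by simp)] at this
    exact this
  have := congrArg (balancedTensorMapRight K b) hzero
  rw [map_zero, map_finsuppSum] at this
  rw [← this]
  refine Finset.sum_congr rfl fun m hm => ?_
  simp only [balancedTensorMapRight_tmul]
  rw [hbα m (Finset.mem_union_left _ hm)]

theorem IsLeftIFRing.isFlatModule (hR : IsLeftIFRing R) {M : Type u} [AddCommGroup M] [Module R M]
    (hM : IsFPInjective R M) : IsFlatModule R M := by
  refine isFlatModule_of_factorization fun N _ _ hN g => ?_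
  obtain ⟨k, a, ha⟩ := (hR N hN).exists_fin
  obtain ⟨b, hb⟩ := hM.exists_extension a ha (Module.finitePresentation_of_surjective _
    (Submodule.mkQ_surjective _) (by rw [Submodule.ker_mkQ]; exact Submodule.fg_range a)) g
  exact ⟨k, a, b, LinearMap.ext hb⟩

theorem isLeftIFRing_of_injective_isFlatModule
    (h : ∀ (M : Type u) [AddCommGroup M] [Module R M], Module.Injective R M → IsFlatModule R M) :
    IsLeftIFRing R := by
  intro M _ _ hM
  obtain ⟨E, _, _, f, hE, hf⟩ := exists_injective_to_injective (R := R) M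
  obtain ⟨F, _, _, _, a, b, rfl⟩ := (h E hE).exists_factorization hM f
  exact ⟨F, _, _, inferInstance, a, Function.Injective.of_comp hf⟩

end Flat

/-! ### Coherence and reduction to cyclic modules. -/

section Coherent

variable {R : Type u} [Ring R]

theorem IsLeftCoherent.finitePresentation_of_fg_pi (hR : IsLeftCoherent R) {n : ℕ}
    (P : Submodule R (Fin n → R)) (hP : P.FG) : Module.FinitePresentation R P := by
  induction n with
  | zero => infer_instance
  | succ n ih =>
    have : Module.Finite R P := Module.Finite.of_fg hP
    let f : P →ₗ[R] R := LinearMap.proj 0 ∘ₗ P.subtype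
    have : Module.FinitePresentation R (LinearMap.range f) := hR _ (Submodule.fg_range f)
    have hker : (LinearMap.ker f.rangeRestrict).FG :=
      Module.FinitePresentation.fg_ker _ f.surjective_rangeRestrict
    have : Module.Finite R (LinearMap.ker f.rangeRestrict) := Module.Finite.of_fg hker
    -- The kernel consists of vectors with zeroth coordinate `0`; dropping it lands in `R^n`, where
    -- induction applies.
    let j : LinearMap.ker f.rangeRestrict →ₗ[R] (Fin n → R) :=
      LinearMap.funLeft R R Fin.succ ∘ₗ P.subtype ∘ₗ Submodule.subtype _
    have hj : Function.Injective j := by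
      rw [injective_iff_map_eq_zero]
      rintro ⟨⟨x, hx⟩, hx'⟩ h
      have h0 : x 0 = 0 := congrArg Subtype.val hx'
      ext i
      refine Fin.cases h0 (fun i => congr_fun h i) i
    have : Module.FinitePresentation R (LinearMap.range j) := ih _ (Submodule.fg_range j)
    have : Module.FinitePresentation R (LinearMap.ker f.rangeRestrict) :=
      (LinearEquiv.finitePresentation_iff (M := LinearMap.ker f.rangeRestrict)
        (LinearEquiv.ofInjective j hj)).2 this
    exact Module.finitePresentation_of_ker _ f.surjective_rangeRestrict

theorem IsLeftCoherent.finitePresentation_of_fg (hR : IsLeftCoherent R) {M : Type u}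
    [AddCommGroup M] [Module R M] [Module.FinitePresentation R M] (N : Submodule R M)
    (hN : N.FG) : Module.FinitePresentation R N := by
  obtain ⟨n, p, hp⟩ := Module.Finite.exists_fin' R M
  have hker := Module.FinitePresentation.fg_ker p hp
  have hle : LinearMap.ker p ≤ N.comap p := fun x hx => by
    rw [Submodule.mem_comap, hx]; exact N.zero_mem
  have := hR.finitePresentation_of_fg_pi (N.comap p) <| by
    apply Submodule.fg_of_fg_map_of_fg_inf_ker p
    · rwa [Submodule.map_comap_eq_of_surjective hp]
    · rwa [inf_eq_right.2 hle]
  refine Module.finitePresentation_of_surjective (p.restrict (p := N.comap p) (q := N)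
    fun _ => id) ?_ ?_
  · rintro ⟨y, hy⟩
    obtain ⟨x, rfl⟩ := hp y
    exact ⟨⟨x, hy⟩, rfl⟩
  · apply Submodule.fg_of_fg_map_injective (N.comap p).subtype Subtype.val_injective
    convert! hker
    ext x
    constructor
    · rintro ⟨y, hy, rfl⟩
      exact congrArg Subtype.val hy
    · intro hx
      exact ⟨⟨x, hle hx⟩, Subtype.ext hx, rfl⟩

/-- Induction on the number of generators. An embedding of a cyclic submodule `N` in `R^k` extends
to `M` by FP-injectivity, as `M ⧸ N` is finitely presented; pairing it with an embedding of `M ⧸ N`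
is injective. -/
theorem IsLeftIFRing.of_cyclic (hR : IsLeftCoherent R) (hinj : IsFPInjective R R)
    (hcyc : ∀ (M : Type u) [AddCommGroup M] [Module R M], Module.FinitePresentation R M →
      (∃ x : M, Submodule.span R {x} = ⊤) → EmbedsInFree R M) : IsLeftIFRing R := by
  intro M _ _ hM
  obtain ⟨n, x, hx⟩ := Submodule.fg_iff_exists_fin_generating_family.1
    (Module.Finite.fg_top (R := R) (M := M))
  induction n generalizing M with
  | zero =>
    have : Subsingleton M := by
      rw [← Submodule.subsingleton_iff R, ← subsingleton_iff_bot_eq_top, ← hx]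
      simp
    exact ⟨R, _, _, inferInstance, 0, Function.injective_of_subsingleton _⟩
  | succ n ih =>
    let N : Submodule R M := Submodule.span R {x 0}
    have hN : N.FG := Submodule.fg_span (Set.finite_singleton _)
    have hNfp := hR.finitePresentation_of_fg N hN
    have hQ : Module.FinitePresentation R (M ⧸ N) :=
      Module.finitePresentation_of_surjective N.mkQ N.mkQ_surjective (by rwa [Submodule.ker_mkQ])
    have hN0 : EmbedsInFree R N := hcyc N hNfp ⟨⟨x 0, Submodule.mem_span_singleton_self _⟩, by
      rw [eq_top_iff]
      rintro ⟨y, hy⟩ -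
      obtain ⟨r, rfl⟩ := Submodule.mem_span_singleton.1 hy
      exact Submodule.mem_span_singleton.2 ⟨r, rfl⟩⟩
    obtain ⟨k, a, ha⟩ := hN0.exists_fin
    obtain ⟨F, _, _, _, b, hb⟩ := ih (M ⧸ N) hQ (fun i => N.mkQ (x i.succ)) <| by
      rw [eq_top_iff, ← N.range_mkQ, ← Submodule.map_top, ← hx, Submodule.map_span_le]
      rintro _ ⟨i, rfl⟩
      refine Fin.cases ?_ (fun i => Submodule.subset_span ⟨i, rfl⟩) i
      have : N.mkQ (x 0) = 0 := by
        rw [← LinearMap.mem_ker, Submodule.ker_mkQ]; exact Submodule.mem_span_singleton_self _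
      rw [this]; exact zero_mem _
    choose e he using fun i => hinj.exists_extension N.subtype N.injective_subtype
      (by rwa [Submodule.range_subtype]) (LinearMap.proj i ∘ₗ a)
    refine ⟨(Fin k → R) × F, _, _, inferInstance, (LinearMap.pi e).prod (b ∘ₗ N.mkQ),
      (injective_iff_map_eq_zero _).2 fun m hm => ?_⟩
    obtain ⟨h1, h2⟩ := Prod.ext_iff.1 hm
    have hmN : m ∈ N := by
      rw [← N.ker_mkQ]
      exact hb (by simpa using h2)
    have : (⟨m, hmN⟩ : N) = 0 := ha <| by
      rw [map_zero]
      ext i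
      exact (he i ⟨m, hmN⟩).symm.trans (congr_fun h1 i)
    exact congrArg Subtype.val this

end Coherent

/-! ### Annihilators between `R^n` and `S^n`. -/

section RegularBimodule

variable (R S : Type u) [Ring R] [Ring S] {U : Type u} [AddCommGroup U] [Module R U] [Module S U]

/-- The element `u` freely generates `U` both as an `R`-module and as an `S`-module. When the two
actions commute, this identifies `S` with `Rᵐᵒᵖ` and `U` with the regular bimodule of `R`. -/
structure IsRegularGenerator (u : U) : Prop where
  left : Function.Bijective fun r : R => r • u
  right : Function.Bijective fun s : S => s • u

variable {R S}

theorem IsRegularGenerator.symm {u : U} (hu : IsRegularGenerator R S u) :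
    IsRegularGenerator S R u := ⟨hu.right, hu.left⟩

/-- The regular module is identified with `U`. -/
noncomputable def IsRegularGenerator.equiv {u : U} (hu : IsRegularGenerator R S u) : R ≃ₗ[R] U :=
  LinearEquiv.ofBijective (LinearMap.toSpanSingleton R U u) hu.left

theorem IsRegularGenerator.free {u : U} (hu : IsRegularGenerator R S u) : Module.Free R U :=
  Module.Free.of_equiv hu.equiv

theorem IsRegularGenerator.finite {u : U} (hu : IsRegularGenerator R S u) : Module.Finite R U :=
  Module.Finite.equiv hu.equiv

variable (R) in
/-- The annihilator in `R^n` of a set of vectors in `S^n`, for the pairing with values in `U`. -/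
def perp (u : U) {n : ℕ} (X : Set (Fin n → S)) : Submodule R (Fin n → R) :=
  ⨅ s ∈ X, LinearMap.ker (Fintype.linearCombination R fun i => s i • u)

theorem mem_perp {u : U} {n : ℕ} {X : Set (Fin n → S)} {r : Fin n → R} :
    r ∈ perp R u X ↔ ∀ s ∈ X, ∑ i, r i • s i • u = 0 := by
  simp [perp, Fintype.linearCombination_apply]

theorem perp_anti (u : U) {n : ℕ} {X Y : Set (Fin n → S)} (h : X ⊆ Y) :
    perp R u Y ≤ perp R u X := fun _ hr => mem_perp.2 fun s hs => mem_perp.1 hr s (h hs)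

/-- The map `R^n → U^t` given by pairing with the vectors in `t`. -/
def pairingMap (R : Type u) [Ring R] [Module R U] (u : U) {n : ℕ} (t : Finset (Fin n → S)) :
    (Fin n → R) →ₗ[R] (t → U) :=
  LinearMap.pi fun s => Fintype.linearCombination R fun i => s.1 i • u

variable (R S)

/-- Every finitely generated submodule of `R^n` is the annihilator of finitely many vectors. -/
def FGIsPerp (u : U) : Prop :=
  ∀ (n : ℕ) (P : Submodule R (Fin n → R)), P.FG →
    ∃ X : Submodule S (Fin n → S), X.FG ∧ perp R u (X : Set (Fin n → S)) = P

/-- Finitely generated submodules of `R^n` satisfy the double annihilator condition. -/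
def FGPerpPerp (u : U) : Prop :=
  ∀ (n : ℕ) (P : Submodule R (Fin n → R)), P.FG →
    perp R u (perp S u (P : Set (Fin n → R)) : Set (Fin n → S)) = P

/-- Annihilators in `S^n` of finitely generated submodules of `R^n` are finitely generated. -/
def FGPerpFG (u : U) : Prop :=
  ∀ (n : ℕ) (P : Submodule R (Fin n → R)), P.FG → (perp S u (P : Set (Fin n → R))).FG

variable {R S} {u : U}

theorem FGPerpPerp.isPerp (h : FGPerpPerp R S u) (h' : FGPerpFG R S u) : FGIsPerp R S u :=
  fun n P hP => ⟨_, h' n P hP, h n P hP⟩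

theorem pairing_comm [SMulCommClass R S U] (u : U) {n : ℕ} (r : Fin n → R) (s : Fin n → S) :
    ∑ i, r i • s i • u = ∑ i, s i • r i • u :=
  Finset.sum_congr rfl fun _ _ => smul_comm _ _ _

theorem perp_span [SMulCommClass R S U] (u : U) {n : ℕ} (X : Set (Fin n → S)) :
    perp R u (Submodule.span S X : Set (Fin n → S)) = perp R u X := by
  ext r
  simp only [mem_perp]
  refine ⟨fun h s hs => h s (Submodule.subset_span hs), fun h s hs => ?_⟩
  rw [pairing_comm]
  have : Submodule.span S X ≤
      LinearMap.ker (Fintype.linearCombination S fun i => r i • u) :=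
    Submodule.span_le.2 fun s hs => by
      rw [SetLike.mem_coe, LinearMap.mem_ker, Fintype.linearCombination_apply, ← pairing_comm]
      exact h s hs
  exact this hs

theorem ker_pairingMap [SMulCommClass R S U] (u : U) {n : ℕ} (t : Finset (Fin n → S)) :
    LinearMap.ker (pairingMap R u t) =
      perp R u (Submodule.span S (t : Set (Fin n → S)) : Set (Fin n → S)) := by
  rw [perp_span]
  ext r
  rw [mem_perp, LinearMap.mem_ker, funext_iff]
  simp [pairingMap, Fintype.linearCombination_apply]

theorem le_perp_perp [SMulCommClass R S U] (u : U) {n : ℕ} (X : Submodule S (Fin n → S)) :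
    X ≤ perp S u (perp R u (X : Set (Fin n → S)) : Set (Fin n → R)) := fun s hs =>
  mem_perp.2 fun r hr => (pairing_comm u r s).symm.trans (mem_perp.1 hr s hs)

variable [SMulCommClass R S U] [SMulCommClass S R U]

theorem perp_perp_perp (u : U) {n : ℕ} (X : Submodule S (Fin n → S)) :
    perp R u (perp S u (perp R u (X : Set (Fin n → S)) : Set (Fin n → R)) : Set (Fin n → S)) =
      perp R u (X : Set (Fin n → S)) :=
  le_antisymm (perp_anti u (le_perp_perp u X)) (le_perp_perp u _)

theorem FGIsPerp.perp_perp (h : FGIsPerp R S u) : FGPerpPerp R S u := by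
  intro n P hP
  obtain ⟨X, -, rfl⟩ := h n P hP
  exact perp_perp_perp u X

/-- If `P` is the annihilator of a finitely generated `X`, the double annihilator condition for `X`
identifies the annihilator of `P` with `X`. -/
theorem FGIsPerp.perp_fg (h : FGIsPerp R S u) (h' : FGIsPerp S R u) : FGPerpFG R S u := by
  intro n P hP
  obtain ⟨X, hX, rfl⟩ := h n P hP
  rwa [h'.perp_perp n X hX]

end RegularBimodule

/-! ### Annihilator conditions as IF, FP-injectivity and coherence. -/

section RegularBimodule

variable {R S : Type u} [Ring R] [Ring S] {U : Type u} [AddCommGroup U] [Module R U] [Module S U]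
  [SMulCommClass R S U] {u : U}

/-- The coordinates of an embedding of `R^n/P` in `R^k` are pairings with `k` vectors of `S^n`,
whose common annihilator is `P`. -/
theorem IsLeftIFRing.fgIsPerp (hu : IsRegularGenerator R S u)
    (h : IsLeftIFRing R) : FGIsPerp R S u := by
  intro n P hP
  obtain ⟨k, f, hf⟩ := (h ((Fin n → R) ⧸ P) (Module.finitePresentation_of_surjective P.mkQ
    P.mkQ_surjective (by rwa [Submodule.ker_mkQ]))).exists_fin
  choose σ hσ using hu.right.2
  let c : Fin k → Fin n → S := fun j i => σ (f (P.mkQ (Pi.single i 1)) j • u)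
  refine ⟨Submodule.span S (Set.range c), Submodule.fg_span (Set.finite_range c), ?_⟩
  ext r
  rw [perp_span, mem_perp, ← P.ker_mkQ, LinearMap.mem_ker, ← map_eq_zero_iff f hf, funext_iff,
    Set.forall_mem_range]
  refine forall_congr' fun j => ?_
  have h1 : f (P.mkQ r) j = ∑ i, r i * f (P.mkQ (Pi.single i 1)) j := by
    conv_lhs => rw [pi_eq_sum_univ' r]
    simp only [map_sum, map_smul, Finset.sum_apply, Pi.smul_apply, smul_eq_mul]
  have h2 : ∑ i, r i • c j i • u = f (P.mkQ r) j • u := by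
    simp only [h1, c, Finset.sum_smul, mul_smul]
    exact Finset.sum_congr rfl fun i _ => congrArg (r i • ·) (hσ _)
  rw [h2, Pi.zero_apply]
  exact ⟨fun h => hu.left.1 (h.trans (zero_smul R u).symm), fun h => by rw [h, zero_smul]⟩

theorem FGIsPerp.isLeftIFRing (hu : IsRegularGenerator R S u)
    (h : FGIsPerp R S u) : IsLeftIFRing R := by
  intro M _ _ hM
  obtain ⟨n, p, hp⟩ := Module.Finite.exists_fin' R M
  obtain ⟨_, ⟨t, rfl⟩, hX⟩ := h n _ (Module.FinitePresentation.fg_ker p hp)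
  rw [← ker_pairingMap] at hX
  have := hu.free
  refine ⟨t → U, _, _, inferInstance, (LinearMap.ker p).liftQ (pairingMap R u t) hX.ge ∘ₗ
    (p.quotKerEquivOfSurjective hp).symm.toLinearMap, ?_⟩
  rw [LinearMap.coe_comp]
  exact (LinearMap.ker_eq_bot.1 (Submodule.ker_liftQ_eq_bot _ _ _ hX.le)).comp
    (LinearEquiv.injective _)

theorem FGPerpPerp.exists_extension (hu : IsRegularGenerator R S u)
    (h : FGPerpPerp S R u) {n : ℕ} (P : Submodule R (Fin n → R))
    (hP : P.FG) (g : P →ₗ[R] U) :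
    ∃ s : Fin n → S, ∀ x : P, Fintype.linearCombination R (fun i => s i • u) x.1 = g x := by
  obtain ⟨m, p, rfl⟩ := Submodule.fg_iff_exists_fin_generating_family.1 hP
  choose σ hσ using hu.right.2
  let c : Fin n → Fin m → S := fun i j => σ (p j i • u)
  have hp : ∀ j, p j ∈ Submodule.span R (Set.range p) := fun j => Submodule.subset_span ⟨j, rfl⟩
  -- Extending `g` means writing `x` as an `S`-combination of the `c i`. By the double annihilator
  -- condition it suffices that each `r` killing all `c i` kills `x`: a relation among the
  -- generators of `P` holds among their images.
  let x : Fin m → S := fun j => σ (g ⟨p j, hp j⟩)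
  have hx : x ∈ Submodule.span S (Set.range c) := by
    rw [← h m _ (Submodule.fg_span (Set.finite_range c)), mem_perp]
    intro r hr
    rw [SetLike.mem_coe, perp_span, mem_perp, Set.forall_mem_range] at hr
    have h0 : ∑ j, r j • (⟨p j, hp j⟩ : Submodule.span R (Set.range p)) = 0 := by
      ext i
      apply hu.left.1
      simp only [Submodule.coe_sum, Submodule.coe_smul, Finset.sum_apply, Pi.smul_apply,
        smul_eq_mul, Finset.sum_smul, mul_smul, ZeroMemClass.coe_zero, Pi.zero_apply, zero_smul]
      rw [← hr i]
      exact Finset.sum_congr rfl fun j _ => congrArg (r j • ·) (hσ _).symm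
    rw [← pairing_comm, ← map_zero g, ← h0, map_sum]
    simp only [map_smul]
    exact Finset.sum_congr rfl fun j _ => congrArg (r j • ·) (hσ _)
  obtain ⟨s, hs⟩ := (Submodule.mem_span_range_iff_exists_fun S).1 hx
  refine ⟨s, fun ⟨y, hy⟩ => ?_⟩
  obtain ⟨r, rfl⟩ := (Submodule.mem_span_range_iff_exists_fun R).1 hy
  have h1 : (⟨∑ j, r j • p j, hy⟩ : Submodule.span R (Set.range p)) = ∑ j, r j • ⟨p j, hp j⟩ := by
    ext; simp
  rw [h1]
  simp only [map_sum, map_smul, Submodule.coe_sum, Submodule.coe_smul]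
  refine Finset.sum_congr rfl fun j _ => congrArg (r j • ·) ?_
  rw [Fintype.linearCombination_apply, pairing_comm]
  calc ∑ i, s i • p j i • u = ∑ i, s i • c i j • u :=
        Finset.sum_congr rfl fun i _ => congrArg (s i • ·) (hσ _).symm
    _ = x j • u := by simp [← hs, Finset.sum_smul, mul_smul]
    _ = _ := hσ _

theorem FGPerpPerp.isFPInjective (hu : IsRegularGenerator R S u)
    (h : FGPerpPerp S R u) : IsFPInjective R U :=
  .of_extension fun _ P hP g =>
    let ⟨_, hs⟩ := h.exists_extension hu P hP g
    ⟨_, hs⟩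

/-- Pairing with `x` factors through the image of the pairing with the generators `t`, and
FP-injectivity extends it to `U^t`. An `R`-linear map `U^t → U` is given by scalars in `S`, which
express `x` through `t`. -/
theorem IsFPInjective.fgPerpPerp (hu : IsRegularGenerator R S u)
    (h : IsFPInjective R U) : FGPerpPerp S R u := by
  classical
  rintro n _ ⟨t, rfl⟩
  refine le_antisymm (fun x hx => ?_) (le_perp_perp u _)
  let φ := pairingMap R u t
  let ψ : (Fin n → R) →ₗ[R] U := Fintype.linearCombination R fun i => x i • u
  have hle : LinearMap.ker φ ≤ LinearMap.ker ψ := by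
    rw [ker_pairingMap]
    intro r hr
    rw [LinearMap.mem_ker, Fintype.linearCombination_apply, pairing_comm]
    exact mem_perp.1 hx r hr
  have := hu.free
  have := hu.finite
  have hfp : Module.FinitePresentation R ((t → U) ⧸ LinearMap.range φ) :=
    Module.finitePresentation_of_free_of_surjective _ (Submodule.mkQ_surjective _)
      (by rw [Submodule.ker_mkQ]; exact Submodule.fg_range φ)
  obtain ⟨e, he⟩ := h.exists_extension (LinearMap.range φ).subtype (Submodule.injective_subtype _)
    (by rwa [Submodule.range_subtype])
    ((LinearMap.ker φ).liftQ ψ hle ∘ₗ φ.quotKerEquivRange.symm.toLinearMap)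
  have he : ∀ r, e (φ r) = ψ r := fun r => by
    have h1 : φ.quotKerEquivRange.symm ⟨φ r, r, rfl⟩ = Submodule.Quotient.mk r := by
      rw [LinearEquiv.symm_apply_eq]; rfl
    refine (he ⟨φ r, r, rfl⟩).trans ?_
    simp [h1]
  choose d hd using fun s : t => hu.right.2 (e (Pi.single s u))
  have hd' : ∀ (s : t) (y : U), e (Pi.single s y) = d s • y := fun s y => by
    obtain ⟨r, rfl⟩ := hu.left.2 y
    simp only at hd ⊢
    rw [Pi.single_smul, map_smul, ← hd, smul_comm]
  have hx' : x = ∑ s : t, d s • s.1 := by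
    ext i
    apply hu.right.1
    have h1 : φ (Pi.single i 1) = ∑ s : t, Pi.single s (s.1 i • u) := by
      ext s
      simp [φ, pairingMap, Fintype.linearCombination_apply_single, Finset.sum_apply,
        Pi.single_apply]
    have h2 := he (Pi.single i 1)
    rw [h1, map_sum] at h2
    simp only [hd', ψ, Fintype.linearCombination_apply_single, one_smul] at h2
    simp [← h2, Finset.sum_smul, mul_smul]
  rw [hx']
  exact sum_mem fun s _ => Submodule.smul_mem _ _ (Submodule.subset_span s.2)

theorem FGPerpFG.isLeftCoherent (hu : IsRegularGenerator R S u)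
    (h : FGPerpFG S R u) : IsLeftCoherent R := by
  intro I hI
  obtain ⟨m, a, rfl⟩ := Submodule.fg_iff_exists_fin_generating_family.1 hI
  choose σ hσ using hu.right.2
  -- The relations among the generators of the ideal form the annihilator of a single vector.
  have hker : LinearMap.ker (Fintype.linearCombination R a) =
      perp R u (Submodule.span S {fun j => σ (a j • u)} : Set (Fin m → S)) := by
    ext r
    simp only [perp_span, mem_perp, Set.mem_singleton_iff, forall_eq, LinearMap.mem_ker]
    have h1 : ∑ j, r j • σ (a j • u) • u = Fintype.linearCombination R a r • u := by
      simp only [Fintype.linearCombination_apply, Finset.sum_smul, smul_eq_mul, mul_smul]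
      exact Finset.sum_congr rfl fun j _ => congrArg (r j • ·) (hσ _)
    rw [h1]
    exact ⟨fun h => by rw [h, zero_smul], fun h => hu.left.1 (h.trans (zero_smul R u).symm)⟩
  rw [← Fintype.range_linearCombination]
  refine Module.finitePresentation_of_surjective _ (LinearMap.surjective_rangeRestrict _) ?_
  rw [LinearMap.ker_rangeRestrict, hker]
  exact h m _ (Submodule.fg_span (Set.finite_singleton _))

theorem IsLeftCoherent.fgPerpFG (hu : IsRegularGenerator R S u)
    (h : IsLeftCoherent R) : FGPerpFG S R u := by
  rintro n _ ⟨t, rfl⟩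
  rw [← ker_pairingMap]
  have := hu.free
  have := hu.finite
  have := Module.finitePresentation_of_projective R (t → U)
  have := h.finitePresentation_of_fg (LinearMap.range (pairingMap R u t)) (Submodule.fg_range _)
  rw [← LinearMap.ker_rangeRestrict]
  exact Module.FinitePresentation.fg_ker _ (LinearMap.surjective_rangeRestrict _)

end RegularBimodule

/-! ### Duals of finitely presented modules. -/

section Duality

variable {R S U : Type u} [Ring R] [Ring S] [AddCommGroup U] [Module R U] [Module S U]
  {u : U}

theorem embedsInFree_of_dual_finite [SMulCommClass R S U] (hu : IsRegularGenerator R S u)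
    {M : Type u} [AddCommGroup M]
    [Module R M] (hsep : ∀ m : M, (∀ φ : M →ₗ[R] U, φ m = 0) → m = 0)
    (hfin : Module.Finite S (M →ₗ[R] U)) : EmbedsInFree R M := by
  obtain ⟨t, ht⟩ := hfin.fg_top
  have := hu.free
  refine ⟨t → U, _, _, inferInstance, LinearMap.pi fun φ => φ.1,
    (injective_iff_map_eq_zero _).2 fun m hm => hsep m fun φ => ?_⟩
  have hφ : φ ∈ Submodule.span S (t : Set (M →ₗ[R] U)) := ht ▸ Submodule.mem_top
  induction hφ using Submodule.span_induction with
  | mem φ hφ => exact congr_fun hm ⟨φ, hφ⟩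
  | zero => rfl
  | add φ φ' _ _ h h' => rw [LinearMap.add_apply, h, h', add_zero]
  | smul s φ _ h => rw [LinearMap.smul_apply, h, smul_zero]

variable [SMulCommClass R S U] [SMulCommClass S R U]

/-- The dual of a quotient of `R^n` is the annihilator of the relations. -/
theorem exists_dual_equiv_perp (hu : IsRegularGenerator R S u) {M : Type u} [AddCommGroup M]
    [Module R M] {n : ℕ} (p : (Fin n → R) →ₗ[R] M) (hp : Function.Surjective p) :
    ∃ e : perp S u (LinearMap.ker p : Set (Fin n → R)) ≃ₗ[S] (M →ₗ[R] U),
      ∀ s r, e s (p r) = ∑ i, r i • s.1 i • u := by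
  have hle : ∀ s : perp S u (LinearMap.ker p : Set (Fin n → R)),
      LinearMap.ker p ≤ LinearMap.ker (Fintype.linearCombination R fun i => s.1 i • u) :=
    fun s r hr => by
      rw [LinearMap.mem_ker, Fintype.linearCombination_apply, pairing_comm]
      exact mem_perp.1 s.2 r hr
  have hq : ∀ r, (p.quotKerEquivOfSurjective hp).symm (p r) = Submodule.Quotient.mk r := fun r => by
    rw [LinearEquiv.symm_apply_eq]; rfl
  let f (s : perp S u (LinearMap.ker p : Set (Fin n → R))) : M →ₗ[R] U :=
    (LinearMap.ker p).liftQ _ (hle s) ∘ₗ (p.quotKerEquivOfSurjective hp).symm.toLinearMap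
  have hf : ∀ s r, f s (p r) = ∑ i, r i • s.1 i • u := fun s r => by
    simp [f, hq, Fintype.linearCombination_apply]
  have hext : ∀ φ ψ : M →ₗ[R] U, (∀ r, φ (p r) = ψ (p r)) → φ = ψ := fun φ ψ h =>
    LinearMap.ext fun m => by obtain ⟨r, rfl⟩ := hp m; exact h r
  let F : perp S u (LinearMap.ker p : Set (Fin n → R)) →ₗ[S] (M →ₗ[R] U) :=
    { toFun := f
      map_add' := fun s s' => hext _ _ fun r => by
        simp [hf, add_smul, Finset.sum_add_distrib]
      map_smul' := fun c s => hext _ _ fun r => by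
        simp [hf, mul_smul, Finset.smul_sum, smul_comm c] }
  refine ⟨LinearEquiv.ofBijective F ⟨?_, fun φ => ?_⟩, hf⟩
  · rw [injective_iff_map_eq_zero]
    intro s hs
    ext i
    apply hu.right.1
    have := hf s (Pi.single i 1)
    rw [show f s = 0 from hs] at this
    rw [← Fintype.linearCombination_apply, Fintype.linearCombination_apply_single] at this
    simpa using this.symm
  · choose s hs using fun i => hu.right.2 (φ (p (Pi.single i 1)))
    have h1 : ∀ r : Fin n → R, ∑ i, r i • s i • u = φ (p r) := fun r => by
      conv_rhs => rw [pi_eq_sum_univ' r]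
      simp only [map_sum, map_smul]
      exact Finset.sum_congr rfl fun i _ => congrArg (r i • ·) (hs i)
    refine ⟨⟨s, mem_perp.2 fun r hr => ?_⟩, hext _ _ fun r => (hf _ r).trans (h1 r)⟩
    rw [← pairing_comm, h1, show p r = 0 from hr, map_zero]

theorem dual_finitePresentation_and_reflexive (hu : IsRegularGenerator R S u)
    (hR : FGIsPerp R S u) (hS : FGIsPerp S R u) {M : Type u} [AddCommGroup M] [Module R M]
    (hM : Module.FinitePresentation R M) :
    Module.FinitePresentation S (M →ₗ[R] U) ∧ (∀ m : M, (∀ φ : M →ₗ[R] U, φ m = 0) → m = 0) ∧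
      ∀ Φ : (M →ₗ[R] U) →ₗ[S] U, ∃ m : M, ∀ φ, φ m = Φ φ := by
  obtain ⟨n, p, hp⟩ := Module.Finite.exists_fin' R M
  have hker := Module.FinitePresentation.fg_ker p hp
  obtain ⟨e, he⟩ := exists_dual_equiv_perp hu p hp
  have hfg := hR.perp_fg hS n _ hker
  refine ⟨?_, fun m hm => ?_, fun Φ => ?_⟩
  -- The dual is a finitely generated submodule of `S^n`, and `S` is left coherent.
  · have := ((hR.perp_fg hS).isLeftCoherent hu.symm).finitePresentation_of_fg_pi _ hfg
    exact .of_equiv e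
  · obtain ⟨r, rfl⟩ := hp m
    rw [← LinearMap.mem_ker, ← hR.perp_perp n _ hker, mem_perp]
    exact fun s hs => (he ⟨s, hs⟩ r).symm.trans (hm _)
  -- A functional on the dual extends from the annihilator to `S^n`, so it is pairing with some `r`,
  -- that is, evaluation at `p r`.
  · obtain ⟨r, hr⟩ := hR.perp_perp.exists_extension hu.symm _ hfg (Φ ∘ₗ e.toLinearMap)
    refine ⟨p r, fun φ => ?_⟩
    obtain ⟨s, rfl⟩ := e.surjective φ
    rw [he, pairing_comm]
    exact hr s

end Duality

/-! ### The regular bimodule and the equivalences. -/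

theorem isRegularGenerator_one (R : Type u) [Ring R] : IsRegularGenerator R Rᵐᵒᵖ (1 : R) where
  left := by simpa using! Function.bijective_id
  right := by simpa using! MulOpposite.unop_bijective

theorem IsWQFRing.isLeftIFRing {R : Type u} [Ring R] (h : IsWQFRing R) :
    IsLeftIFRing R ∧ IsLeftIFRing Rᵐᵒᵖ := by
  refine ⟨fun M _ _ hM => ?_, fun N _ _ hN => ?_⟩
  · have := h.dual_left M hM
    exact embedsInFree_of_dual_finite (isRegularGenerator_one R) (fun m hm =>
      (injective_iff_map_eq_zero _).1 (h.eval_left M hM).1 m (LinearMap.ext hm)) inferInstance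
  · have := h.dual_right N hN
    exact embedsInFree_of_dual_finite (isRegularGenerator_one R).symm (fun m hm =>
      (injective_iff_map_eq_zero _).1 (h.eval_right N hN).1 m (LinearMap.ext hm)) inferInstance

theorem isWQFRing_of_isLeftIFRing {R : Type u} [Ring R] (h : IsLeftIFRing R)
    (h' : IsLeftIFRing Rᵐᵒᵖ) : IsWQFRing R := by
  have hu := isRegularGenerator_one R
  have hl := h.fgIsPerp hu
  have hr := h'.fgIsPerp hu.symm
  refine ⟨fun M _ _ hM => (dual_finitePresentation_and_reflexive hu hl hr hM).1,
    fun N _ _ hN => (dual_finitePresentation_and_reflexive hu.symm hr hl hN).1,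
    fun M _ _ hM => ?_, fun N _ _ hN => ?_⟩
  · obtain ⟨-, hi, hs⟩ := dual_finitePresentation_and_reflexive hu hl hr hM
    refine ⟨(injective_iff_map_eq_zero _).2 fun m hm => hi m fun φ => congr($hm φ), fun Φ => ?_⟩
    obtain ⟨m, hm⟩ := hs Φ
    exact ⟨m, LinearMap.ext hm⟩
  · obtain ⟨-, hi, hs⟩ := dual_finitePresentation_and_reflexive hu.symm hr hl hN
    refine ⟨(injective_iff_map_eq_zero _).2 fun m hm => hi m fun φ => congr($hm φ), fun Φ => ?_⟩
    obtain ⟨m, hm⟩ := hs Φ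
    exact ⟨m, LinearMap.ext hm⟩

theorem mainTheorem4 (R : Type u) [Ring R] :
    List.TFAE [
      IsWQFRing R,
      IsLeftIFRing R ∧ IsLeftIFRing Rᵐᵒᵖ,
      IsLeftCoherent R ∧ IsFPInjective R R ∧
        ∀ (M : Type u) [AddCommGroup M] [Module R M], Module.FinitePresentation R M →
          (∃ x : M, Submodule.span R {x} = ⊤) → EmbedsInFree R M,
      (∀ (M : Type u) [AddCommGroup M] [Module R M], IsFPInjective R M → IsFlatModule R M) ∧
        ∀ (N : Type u) [AddCommGroup N] [Module Rᵐᵒᵖ N],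
          IsFPInjective Rᵐᵒᵖ N → IsFlatModule Rᵐᵒᵖ N,
      (∀ (M : Type u) [AddCommGroup M] [Module R M], Module.Injective R M → IsFlatModule R M) ∧
        ∀ (N : Type u) [AddCommGroup N] [Module Rᵐᵒᵖ N],
          Module.Injective Rᵐᵒᵖ N → IsFlatModule Rᵐᵒᵖ N] := by
  have hu := isRegularGenerator_one R
  tfae_have 1 → 2 := fun h => h.isLeftIFRing
  tfae_have 2 → 1 := fun h => isWQFRing_of_isLeftIFRing h.1 h.2
  tfae_have 2 → 3 := fun ⟨h, h'⟩ =>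
    have hl := h.fgIsPerp hu
    have hr := h'.fgIsPerp hu.symm
    ⟨(hr.perp_fg hl).isLeftCoherent hu, hr.perp_perp.isFPInjective hu, fun M _ _ hM _ => h M hM⟩
  -- Left coherence and FP-injectivity on the left control annihilators of right submodules, hence
  -- give the right IF condition.
  tfae_have 3 → 2 := fun ⟨hcoh, hinj, hcyc⟩ =>
    ⟨.of_cyclic hcoh hinj hcyc,
      ((hinj.fgPerpPerp hu).isPerp (hcoh.fgPerpFG hu)).isLeftIFRing hu.symm⟩
  tfae_have 2 → 4 := fun h => ⟨fun M _ _ hM => h.1.isFlatModule hM, fun N _ _ hN =>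
    h.2.isFlatModule hN⟩
  tfae_have 4 → 5 := fun h => ⟨fun M _ _ hM => h.1 M hM.isFPInjective, fun N _ _ hN =>
    h.2 N hN.isFPInjective⟩
  tfae_have 5 → 2 := fun h => ⟨isLeftIFRing_of_injective_isFlatModule h.1,
    isLeftIFRing_of_injective_isFlatModule h.2⟩
  tfae_finish
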